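/- Let $n,m\in\mathbb N$, let $f:\mathbb R^n\to\mathbb R$ and $g:\mathbb R^m\to\mathbb R$ be convex and continuously differentiable, let $K:\mathbb R^n\to\mathbb R^m$ be linear, and put $\mathcal L(x,y)=f(x)+\langle Kx,y\rangle-g(y)$. Assume that the set $\Omega\subseteq\mathbb R^n\times\mathbb R^m$ of saddle points of $\mathcal L$, i.e. of pairs $(x^*,y^*)$ with $\mathcal L(x^*,y)\le\mathcal L(x^*,y^*)\le\mathcal L(x,y^*)$ for all $(x,y)$, is nonempty. Let $\alpha>1$, $0<q<1$, $p>0$, $c>0$, $t_0>0$, and let $\beta:[t_0,+\infty)\to(0,+\infty)$ be continuously differentiable and nondecreasing. Let $(x(t),y(t))_{t\ge t_0}$ be a global (twice differentiable) solution of $$\begin{cases}\ddot x(t)+\frac{\alpha}{t^q}\dot x(t)+\beta(t)\Big(\nabla_x\mathcal L\big(x(t),y(t)+\tfrac{t^q}{\alpha-1}\dot y(t)\big)+\tfrac{c}{t^p}x(t)\Big)=0,\\[2pt] \ddot y(t)+\frac{\alpha}{t^q}\dot y(t)-\beta(t)\Big(\nabla_y\mathcal L\big(x(t)+\tfrac{t^q}{\alpha-1}\dot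 x(t),y(t)\big)-\tfrac{c}{t^p}y(t)\Big)=0,\end{cases}\qquad t\ge t_0 .$$ Suppose that there is a constant $M$ with $0<M\le q\left(1+\frac{1}{2\alpha-1}\right)$ such that $$\frac{\dot\beta(t)}{\beta(t)}\le\frac{\alpha-1}{t^q}-\frac{M}{t}\quad\text{for all }t\ge t_0,\qquad\text{and}\qquad \lim_{t\to+\infty}t^{M-p}\beta(t)=+\infty,$$ and that $$\int_{t_0}^{+\infty}t^{-q-p}\beta(t)\,dt<+\infty .$$ Equip $\mathbb R^n\times\mathbb R^m$ with the norm $\|(x,y)\|=\sqrt{\|x\|^2+\|y\|^2}$. Then $\Omega$ has exactly one element $(\bar x^*,\bar y^*)=\operatorname{Proj}_\Omega 0$ of minimal norm, and $$\liminf_{t\to+\infty}\|(x(t),y(t))-(\bar x^*,\bar y^*)\|=0 .$$ Further, if there is $T\ge t_0$ such that either $(x(t),y(t))$ lies in the open ball $\mathbb B(0,\|(\bar x^*,\bar y^*)\|)$ for all $t\ge T$, or it lies in the complement of this ball for all $t\ge T$, then $$\lim_{t\to+\infty}\|(x(t),y(t))-(\bar x^*,\bar y^*)\|=0 .$$ 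-/

import Mathlib

open Filter Topology MeasureTheory Set

/-- The convex-concave Lagrangian with bilinear coupling, `L(x, y) = f(x) + ⟨K x, y⟩ - g(y)`. -/
noncomputable def lagrangian {n m : ℕ}
    (f : EuclideanSpace ℝ (Fin n) → ℝ) (g : EuclideanSpace ℝ (Fin m) → ℝ)
    (K : EuclideanSpace ℝ (Fin n) →L[ℝ] EuclideanSpace ℝ (Fin m))
    (x : EuclideanSpace ℝ (Fin n)) (y : EuclideanSpace ℝ (Fin m)) : ℝ :=
  f x + inner ℝ (K x) y - g y

/-- The gradient of a function of two variables with respect to the first one. -/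
noncomputable def gradFst {n m : ℕ}
    (L : EuclideanSpace ℝ (Fin n) → EuclideanSpace ℝ (Fin m) → ℝ)
    (x : EuclideanSpace ℝ (Fin n)) (y : EuclideanSpace ℝ (Fin m)) : EuclideanSpace ℝ (Fin n) :=
  gradient (fun u => L u y) x

/-- The gradient of a function of two variables with respect to the second one. -/
noncomputable def gradSnd {n m : ℕ}
    (L : EuclideanSpace ℝ (Fin n) → EuclideanSpace ℝ (Fin m) → ℝ)
    (x : EuclideanSpace ℝ (Fin n)) (y : EuclideanSpace ℝ (Fin m)) : EuclideanSpace ℝ (Fin m) :=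
  gradient (fun v => L x v) y

/-- The set of saddle points of `L`, as a subset of `ℝⁿ × ℝᵐ` with the Euclidean norm
`‖(x, y)‖ = √(‖x‖² + ‖y‖²)` (this is the norm of `WithLp 2`). -/
def saddleSet {n m : ℕ}
    (L : EuclideanSpace ℝ (Fin n) → EuclideanSpace ℝ (Fin m) → ℝ) :
    Set (WithLp 2 (EuclideanSpace ℝ (Fin n) × EuclideanSpace ℝ (Fin m))) :=
  {z | ∀ (x : EuclideanSpace ℝ (Fin n)) (y : EuclideanSpace ℝ (Fin m)),
    L z.fst y ≤ L z.fst z.snd ∧ L z.fst z.snd ≤ L x z.snd}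

/-- `Proj_D 0`: the set of points of `D` that are closest to the origin. -/
def projZero {E : Type*} [NormedAddCommGroup E] (D : Set E) : Set E :=
  {z | z ∈ D ∧ ∀ w ∈ D, ‖z‖ ≤ ‖w‖}

/-- `(x, y)` is a global (classical) solution on `[t₀, ∞)` of
`x'' + (α / t^q) x' + β(t) (∇ₓL(x, y + t^q/(α-1) y') + (c / t^p) x) = 0`,
`y'' + (α / t^q) y' - β(t) (∇_yL(x + t^q/(α-1) x', y) - (c / t^p) y) = 0`.
Derivatives at the end point `t₀` are one-sided. -/
def IsGlobalSolution {n m : ℕ}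
    (L : EuclideanSpace ℝ (Fin n) → EuclideanSpace ℝ (Fin m) → ℝ)
    (α q p c t₀ : ℝ) (β : ℝ → ℝ)
    (x : ℝ → EuclideanSpace ℝ (Fin n)) (y : ℝ → EuclideanSpace ℝ (Fin m)) : Prop :=
  ∃ (x' x'' : ℝ → EuclideanSpace ℝ (Fin n)) (y' y'' : ℝ → EuclideanSpace ℝ (Fin m)),
    ∀ t : ℝ, t₀ ≤ t →
      HasDerivWithinAt x (x' t) (Ici t₀) t ∧ HasDerivWithinAt x' (x'' t) (Ici t₀) t ∧
      HasDerivWithinAt y (y' t) (Ici t₀) t ∧ HasDerivWithinAt y' (y'' t) (Ici t₀) t ∧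
      x'' t + (α / t ^ q) • x' t
        + β t • (gradFst L (x t) (y t + (t ^ q / (α - 1)) • y' t) + (c / t ^ p) • x t) = 0 ∧
      y'' t + (α / t ^ q) • y' t
        - β t • (gradSnd L (x t + (t ^ q / (α - 1)) • x' t) (y t) - (c / t ^ p) • y t) = 0

/-! Write z = (x, y), φ = f + g, J(x, y) = (K*y, -Kx), a = α - 1, θ = t^q / a, ε = c / t^p. The
system becomes one equation driven by ∇φ(z) + J(z + θz') + εz with J skew, and saddle points are the
zeros of ∇φ + J. Let w be the one of minimal norm and k = z - w + θz'. The extrapolation inside J is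
exactly what makes k' contain J k, which is orthogonal to k.

With H(u) = φ(u) - φ(w) + ⟨Jw, u⟩ and Q = θ²βε → ∞, the energy R = H(z)/ε + (‖z‖² - σ)/2 + ‖k‖²/(2Q)
satisfies θR' ≤ -κR + (‖w‖² - σ)/2 once σ ≤ ‖z‖² (`exists_hasDerivAt_lyapunov_le`). Since q < 1, 1/θ
has infinite integral, so R is eventually at most (‖w‖² - σ)/(2κ) + δ.

Taking σ = 0 bounds z and gives H(z) → 0. A zero of H need not be a saddle point; `tendsto_coupling`
supplies the missing J(z - w) → 0, so every cluster point of z is a saddle point. Taking σ = ‖w‖²,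
allowed when z stays outside the ball, gives limsup ‖z‖ ≤ ‖w‖. So z → w along any filter on which
‖z‖ ≤ ‖w‖, and along `atTop` if eventually ‖z‖ ≥ ‖w‖. One of these always occurs on some nontrivial
filter, whence the liminf. -/

/-! ### Decay from differential inequalities with rate a / t^q -/

/-- Differential inequality `N' ≤ (-κ N + S) / (t ^ q / a)`, integrated. -/
lemma le_add_exp_of_deriv_le_div_rpow {N N' : ℝ → ℝ} {a q κ S T : ℝ} (hq : q < 1)
    (hT : 0 < T) (hκ : 0 < κ) (hN : ∀ t, T ≤ t → HasDerivAt N (N' t) t)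
    (h : ∀ t, T ≤ t → N' t ≤ (-κ * N t + S) / (t ^ q / a)) :
    ∀ t, T ≤ t → N t ≤ S / κ +
      (N T - S / κ) * Real.exp (κ * a / (1 - q) * (T ^ (1 - q) - t ^ (1 - q))) := by
  -- b t^(1-q) is a primitive of κ / (t^q / a), so its exponential is the integrating factor.
  set b := κ * a / (1 - q) with hb
  set F : ℝ → ℝ := fun t => (N t - S / κ) * Real.exp (b * t ^ (1 - q)) with hF
  have hq' : (1 - q) ≠ 0 := by linarith
  have hd : ∀ t, T ≤ t → HasDerivAt F (N' t * Real.exp (b * t ^ (1 - q)) +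
      (N t - S / κ) * (Real.exp (b * t ^ (1 - q)) * (b * ((1 - q) * t ^ (1 - q - 1))))) t := by
    intro t ht
    have ht0 : 0 < t := hT.trans_le ht
    exact ((hN t ht).sub_const _).mul
      (((Real.hasDerivAt_rpow_const (Or.inl ht0.ne')).const_mul b).exp)
  have hanti : AntitoneOn F (Ici T) := by
    apply antitoneOn_of_deriv_nonpos (convex_Ici T)
    · exact fun t ht => (hd t ht).continuousAt.continuousWithinAt
    · intro t ht
      rw [interior_Ici] at ht
      exact (hd t (le_of_lt ht)).differentiableAt.differentiableWithinAt
    · intro t ht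
      rw [interior_Ici] at ht
      have ht' : T ≤ t := le_of_lt ht
      have ht0 : 0 < t := hT.trans_le ht'
      rw [(hd t ht').deriv]
      have h1 : t ^ (1 - q - 1) = (t ^ q)⁻¹ := by
        rw [show 1 - q - 1 = -q by ring, Real.rpow_neg ht0.le]
      have h2 := h t ht'
      have h3 : (-κ * N t + S) / (t ^ q / a) = -((N t - S / κ) * (b * ((1 - q) * (t ^ q)⁻¹))) := by
        rw [hb]; field_simp; ring
      rw [h1]
      have := Real.exp_pos (b * t ^ (1 - q))
      rw [h3] at h2
      nlinarith
  intro t ht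
  have h1 : F t ≤ F T := hanti (mem_Ici.2 le_rfl) (mem_Ici.2 ht) ht
  have h2 := Real.exp_pos (b * t ^ (1 - q))
  rw [mul_sub, Real.exp_sub, ← sub_le_iff_le_add', ← mul_div_assoc, le_div_iff₀ h2]
  exact h1

lemma tendsto_exp_neg_rpow {b q T : ℝ} (hq : q < 1) (hb : 0 < b) :
    Tendsto (fun t : ℝ => Real.exp (b * (T ^ (1 - q) - t ^ (1 - q)))) atTop (𝓝 0) := by
  apply Real.tendsto_exp_atBot.comp
  apply Tendsto.const_mul_atBot hb
  exact tendsto_atBot_add_const_left _ _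
    (tendsto_neg_atTop_atBot.comp (tendsto_rpow_atTop (by linarith)))

lemma eventually_le_of_deriv_le_div_rpow {N N' : ℝ → ℝ} {a q κ S T : ℝ} (ha : 0 < a) (hq : q < 1)
    (hT : 0 < T) (hκ : 0 < κ) (hN : ∀ t, T ≤ t → HasDerivAt N (N' t) t)
    (h : ∀ t, T ≤ t → N' t ≤ (-κ * N t + S) / (t ^ q / a)) {δ : ℝ} (hδ : 0 < δ) :
    ∀ᶠ t in atTop, N t ≤ S / κ + δ := by
  have h1 := le_add_exp_of_deriv_le_div_rpow hq hT hκ hN h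
  have h2 : Tendsto (fun t : ℝ => (N T - S / κ) *
      Real.exp (κ * a / (1 - q) * (T ^ (1 - q) - t ^ (1 - q)))) atTop (𝓝 0) := by
    simpa using (tendsto_exp_neg_rpow (T := T) hq
      (div_pos (mul_pos hκ ha) (sub_pos.2 hq))).const_mul (N T - S / κ)
  filter_upwards [eventually_ge_atTop T, h2.eventually (gt_mem_nhds hδ)] with t ht h3
  linarith [h1 t ht]

/-- Apply the scalar estimate to ‖V‖², using 2⟨V, r - V⟩ ≤ ‖r‖² - ‖V‖². -/
lemma tendsto_zero_of_deriv_eq_div_rpow {E : Type*} [NormedAddCommGroup E] [InnerProductSpace ℝ E]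
    {V V' r : ℝ → E} {a q : ℝ} (ha : 0 < a) (hq : q < 1)
    (hV : ∀ᶠ t in atTop, HasDerivAt V (V' t) t)
    (h : ∀ᶠ t in atTop, V' t = (t ^ q / a)⁻¹ • (r t - V t))
    (hr : Tendsto r atTop (𝓝 0)) : Tendsto V atTop (𝓝 0) := by
  have key : ∀ δ > 0, ∀ᶠ t in atTop, ‖V t‖ ^ 2 < δ := by
    intro δ hδ
    have hr' : ∀ᶠ t in atTop, ‖r t‖ ^ 2 < δ / 2 := by
      have : Tendsto (fun t => ‖r t‖ ^ 2) atTop (𝓝 0) := by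
        simpa using (hr.norm.pow 2)
      exact this.eventually (gt_mem_nhds (by positivity))
    obtain ⟨T, hT⟩ := eventually_atTop.1 (hV.and (h.and (hr'.and (eventually_gt_atTop 0))))
    have hT0 : 0 < T := (hT T le_rfl).2.2.2
    have := eventually_le_of_deriv_le_div_rpow (N := fun t => ‖V t‖ ^ 2)
      (N' := fun t => 2 * inner ℝ (V t) (V' t)) (κ := 1) (S := δ / 2) (δ := δ / 4) ha hq hT0 one_pos
      (fun t ht => (hT t ht).1.norm_sq) ?_ (by positivity)
    · filter_upwards [this] with t ht
      linarith
    · intro t ht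
      obtain ⟨-, h1, h2, h3⟩ := hT t ht
      have hp : 0 < t ^ q / a := div_pos (Real.rpow_pos_of_pos h3 q) ha
      rw [h1, inner_smul_right, inner_sub_right, real_inner_self_eq_norm_sq,
        div_eq_inv_mul (_ + _), mul_left_comm]
      apply mul_le_mul_of_nonneg_left _ (inv_pos.2 hp).le
      have h4 := real_inner_le_norm (V t) (r t)
      nlinarith [sq_nonneg (‖V t‖ - ‖r t‖)]
  rw [tendsto_zero_iff_norm_tendsto_zero, Metric.tendsto_nhds]
  intro δ hδ
  filter_upwards [key (δ ^ 2) (by positivity)] with t ht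
  rw [dist_zero_right, norm_norm]
  exact lt_of_pow_lt_pow_left₀ 2 hδ.le ht

/-! ### Pointwise derivative computations for the energy and the coupling -/

lemma ConvexOn.sub_le_inner_gradient {E : Type*} [NormedAddCommGroup E] [InnerProductSpace ℝ E]
    [CompleteSpace E] {φ : E → ℝ} (hφ : ConvexOn ℝ univ φ) {z g : E} (hg : HasGradientAt φ g z)
    (w : E) : φ z - φ w ≤ inner ℝ g (z - w) := by
  have hc : ConvexOn ℝ univ (fun s : ℝ => φ (AffineMap.lineMap z w s)) := by
    exact hφ.comp_affineMap (AffineMap.lineMap z w : ℝ →ᵃ[ℝ] E)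
  have hd : HasDerivAt (fun s : ℝ => φ (AffineMap.lineMap z w s)) (inner ℝ g (w - z)) 0 := by
    have h1 : HasDerivAt (fun s : ℝ => (AffineMap.lineMap z w s : E)) (w - z) 0 :=
      AffineMap.hasDerivAt_lineMap
    have h2 : HasFDerivAt φ (InnerProductSpace.toDual ℝ E g)
        ((fun s : ℝ => (AffineMap.lineMap z w s : E)) 0) := by
      simpa using hg.hasFDerivAt
    exact h2.comp_hasDerivAt 0 h1
  have := hc.le_slope_of_hasDerivAt (mem_univ 0) (mem_univ 1) one_pos hd
  simp [slope_def_field] at this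
  rw [← neg_sub w z, inner_neg_right]
  linarith

/-- Since θδ = 1 + 1/a, the damping cancels z' and leaves -(1/a - θ')z'; splitting J(z + θz') as J w
plus J of the shifted velocity isolates the part killed by skewness. -/
lemma hasDerivAt_shifted_velocity {E : Type*} [NormedAddCommGroup E] [InnerProductSpace ℝ E]
    {z z' : ℝ → E} {z'' w F : E} {J : E →L[ℝ] E} {θ : ℝ → ℝ} {θ' a δ b e t : ℝ}
    (hz : HasDerivAt z (z' t) t) (hz' : HasDerivAt z' z'' t) (hθ : HasDerivAt θ θ' t)
    (hδ : θ t * δ = 1 + 1 / a)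
    (hode : z'' + δ • z' t + b • (F + J (z t + θ t • z' t) + e • z t) = 0) :
    HasDerivAt (fun s => z s - w + θ s • z' s)
      (-(1 / a - θ') • z' t - (θ t * b) • (F + J w + e • z t + J (z t - w + θ t • z' t))) t := by
  refine ((hz.sub_const w).add (hθ.smul hz')).congr_deriv ?_
  have h1 : z'' = -(δ • z' t + b • (F + J (z t + θ t • z' t) + e • z t)) := by
    rw [eq_neg_iff_add_eq_zero, ← hode]; abel
  have h2 : F + J w + e • z t + J (z t - w + θ t • z' t) = F + J (z t + θ t • z' t) + e • z t := by
    simp only [map_add, map_sub]; abel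
  have h3 : 1 / a = θ t * δ - 1 := by rw [hδ]; ring
  rw [h1, h2, h3]
  module

/-- Here h = z - w, and doubled letters are squared norms. The hh/2 lost to Young's inequality in
the kh term is recovered from zh. Half of the remaining k-decay 1/(4a) pays for Q', and κ ≤ 1/2 pays
for the decay of ε. -/
lemma lyapunov_rate_le {H gh zh kh kk hh zz ww Q Q' θ ε μ ν a κ σ : ℝ} (ha : 0 < a)
    (hθ : 0 < θ) (hε : 0 < ε) (hH : 0 ≤ H) (hconv : H ≤ gh) (hkk : 0 ≤ kk) (hhh : 0 ≤ hh)
    (hkh : kh ≤ (kk + hh) / 2) (hzh : zh = (zz - ww + hh) / 2) (hσ : σ ≤ zz)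
    (hμ1 : 1 / (2 * a) ≤ μ) (hμ2 : μ ≤ 1 / a) (hν : ν * θ ≤ κ) (hκ2 : κ ≤ 1 / 2)
    (hκa : κ ≤ 1 / (4 * a)) (hQ : 1 / a ≤ Q) (hQ' : -ν * Q ≤ Q') :
    (ν * H - gh / θ) / ε - zh / θ - μ * (kk - kh) / Q / θ - kk * Q' / (2 * Q ^ 2) ≤
      (-κ * (H / ε + (zz - σ) / 2 + kk / (2 * Q)) + (ww - σ) / 2) / θ := by
  have hQ0 : 0 < Q := lt_of_lt_of_le (by positivity) hQ
  have T1 : (ν * H - gh / θ) / ε ≤ -κ * (H / ε) / θ := by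
    rw [show -κ * (H / ε) / θ = (-κ * H / θ) / ε by ring]
    gcongr
    rw [le_div_iff₀ hθ, sub_mul, div_mul_cancel₀ _ hθ.ne']
    nlinarith
  have hμ0 : 0 ≤ μ := le_trans (by positivity) hμ1
  have T3 : -(μ * (kk - kh) / Q) ≤ -(1 / (4 * a)) * (kk / Q) + hh / 2 := by
    have h1 : μ * hh ≤ Q * hh := mul_le_mul_of_nonneg_right (hμ2.trans hQ) hhh
    have h2 : 1 / (4 * a) = 1 / (2 * a) / 2 := by field_simp; norm_num
    rw [← mul_div_assoc, ← neg_div, div_add' _ _ _ hQ0.ne', div_le_div_iff_of_pos_right hQ0, h2]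
    have h3 := mul_le_mul_of_nonneg_left hkh hμ0
    have h4 := mul_le_mul_of_nonneg_right hμ1 hkk
    linarith
  have T4 : -(kk * Q' / (2 * Q ^ 2)) ≤ κ * (kk / Q) / 2 / θ := by
    have h2 : ν ≤ κ / θ := by rwa [le_div_iff₀ hθ]
    have h3 : -(κ / θ) * Q ≤ Q' := by nlinarith
    have h4 : kk * (-(κ / θ) * Q) / (2 * Q ^ 2) ≤ kk * Q' / (2 * Q ^ 2) := by gcongr
    have h5 : kk * (-(κ / θ) * Q) / (2 * Q ^ 2) = -(κ * (kk / Q) / 2 / θ) := by field_simp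
    linarith
  have T3' := div_le_div_of_nonneg_right T3 hθ.le
  rw [neg_div] at T3'
  have h0 : 0 ≤ kk / Q := by positivity
  have h6 : kk / (2 * Q) = (kk / Q) / 2 := by field_simp
  calc _ ≤ -κ * (H / ε) / θ - zh / θ + (-(1 / (4 * a)) * (kk / Q) + hh / 2) / θ +
      κ * (kk / Q) / 2 / θ := by linarith
    _ = (-κ * (H / ε) - zh + -(1 / (4 * a)) * (kk / Q) + hh / 2 + κ * (kk / Q) / 2) / θ := by
        ring
    _ ≤ _ := by
        apply div_le_div_of_nonneg_right _ hθ.le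
        rw [hzh, h6]
        have h7 := mul_le_mul_of_nonneg_right hκ2 (sub_nonneg.2 hσ)
        have h8 := mul_le_mul_of_nonneg_right hκa h0
        linarith

/-- Substituting z' = (k - h)/θ, the weights 1/ε, 1/2 and 1/(2Q) with Q = θ²bε make all products of
k with g and with z cancel; the products of h with g and with z are controlled by convexity and by
expanding ‖z - h‖². -/
lemma exists_hasDerivAt_lyapunov_le {E : Type*} [NormedAddCommGroup E] [InnerProductSpace ℝ E]
    [CompleteSpace E] {z k : ℝ → E} {z' w g jk : E} {H : E → ℝ} {Q ε : ℝ → ℝ}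
    {θ b Q' μ ν a κ σ t : ℝ} (ha : 0 < a) (hθ0 : 0 < θ)
    (hε : HasDerivAt ε (-ν * ε t) t) (hε0 : 0 < ε t) (hH : HasGradientAt H g (z t))
    (hconv : H (z t) ≤ inner ℝ g (z t - w)) (hH0 : 0 ≤ H (z t)) (hz : HasDerivAt z z' t)
    (hk : HasDerivAt k (-μ • z' - (θ * b) • (g + ε t • z t + jk)) t)
    (hkz : k t = z t - w + θ • z') (hjk : inner ℝ (k t) jk = 0)
    (hμ1 : 1 / (2 * a) ≤ μ) (hμ2 : μ ≤ 1 / a) (hν : ν * θ ≤ κ) (hκ2 : κ ≤ 1 / 2)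
    (hκa : κ ≤ 1 / (4 * a)) (hQe : Q t = θ ^ 2 * b * ε t) (hQ : 1 / a ≤ Q t)
    (hQd : HasDerivAt Q Q' t) (hQ' : -ν * Q t ≤ Q') (hσ : σ ≤ ‖z t‖ ^ 2) :
    ∃ R', HasDerivAt (fun s => H (z s) / ε s + (‖z s‖ ^ 2 - σ) / 2 +
        ‖k s‖ ^ 2 / (2 * Q s)) R' t ∧
      R' ≤ (-κ * (H (z t) / ε t + (‖z t‖ ^ 2 - σ) / 2 +
        ‖k t‖ ^ 2 / (2 * Q t)) + (‖w‖ ^ 2 - σ) / 2) / θ := by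
  have hHz : HasDerivAt (fun s => H (z s)) (inner ℝ g z') t :=
    hH.hasFDerivAt.comp_hasDerivAt t hz
  have hQ0 : 0 < Q t := lt_of_lt_of_le (by positivity) hQ
  have hR := ((hHz.div hε hε0.ne').add ((hz.norm_sq.sub_const σ).div_const 2)).add
    (hk.norm_sq.div (hQd.const_mul 2) (mul_pos two_pos hQ0).ne')
  refine ⟨_, hR, ?_⟩
  obtain ⟨h, hh⟩ : ∃ h, h = z t - w := ⟨_, rfl⟩
  rw [← hh] at hconv
  have hz'e : z' = θ⁻¹ • (k t - h) := by
    rw [hkz, hh, add_sub_cancel_left, smul_smul, inv_mul_cancel₀ hθ0.ne', one_smul]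
  have hkz' : inner ℝ (k t) z' = (‖k t‖ ^ 2 - inner ℝ (k t) h) / θ := by
    rw [hz'e, inner_smul_right, inner_sub_right, real_inner_self_eq_norm_sq, div_eq_inv_mul]
  have hgz' : inner ℝ g z' = (inner ℝ (k t) g - inner ℝ g h) / θ := by
    rw [hz'e, inner_smul_right, inner_sub_right, real_inner_comm (k t) g, div_eq_inv_mul]
  have hzz' : inner ℝ (z t) z' = (inner ℝ (k t) (z t) - inner ℝ (z t) h) / θ := by
    rw [hz'e, inner_smul_right, inner_sub_right, real_inner_comm (k t) (z t), div_eq_inv_mul]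
  have hkh : inner ℝ (k t) h ≤ (‖k t‖ ^ 2 + ‖h‖ ^ 2) / 2 := by
    have := real_inner_le_norm (k t) h
    nlinarith [sq_nonneg (‖k t‖ - ‖h‖)]
  have hzh : inner ℝ (z t) h = (‖z t‖ ^ 2 - ‖w‖ ^ 2 + ‖h‖ ^ 2) / 2 := by
    have : ‖w‖ ^ 2 = ‖z t - h‖ ^ 2 := by rw [hh, sub_sub_cancel]
    rw [this, norm_sub_sq_real]; ring
  refine le_of_eq_of_le ?_ (lyapunov_rate_le ha hθ0 hε0 hH0 hconv (by positivity) (by positivity)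
    hkh hzh hσ hμ1 hμ2 hν hκ2 hκa hQ hQ')
  simp only [inner_sub_right, inner_add_right, inner_smul_right, hjk, hkz', hgz', hzz']
  have hb : b = Q t / (θ ^ 2 * ε t) := by rw [hQe]; field_simp
  rw [hb]
  generalize inner ℝ (k t) h = kh
  generalize inner ℝ (z t) h = zh
  generalize inner ℝ g h = gh
  generalize inner ℝ (k t) g = kg
  generalize inner ℝ (k t) (z t) = kz
  generalize ‖k t‖ ^ 2 = kk
  generalize H (z t) = Hv
  generalize Q t = Qt at *
  generalize ε t = e at *
  field_simp
  ring

/-- The weight ω = 1/(θ²b) makes the term -ωθb J k cancel the J k / θ coming from J z', leaving -J(z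
- w)/θ: a relaxation equation for J(z - w) + ωk. -/
lemma hasDerivAt_coupling {E : Type*} [NormedAddCommGroup E] [InnerProductSpace ℝ E]
    {z k : ℝ → E} {z' w g : E} {J : E →L[ℝ] E} {ω : ℝ → ℝ} {θ b e μ ξ t : ℝ} (hθ : 0 < θ)
    (hb : 0 < b) (hz : HasDerivAt z z' t) (hω : HasDerivAt ω (-(ξ / θ) * ω t) t)
    (hωe : ω t = (θ ^ 2 * b)⁻¹)
    (hk : HasDerivAt k (-μ • z' - (θ * b) • (g + e • z t + J (k t))) t)
    (hkz : k t = z t - w + θ • z') :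
    HasDerivAt (fun s => J (z s - w) + ω s • k s)
      (θ⁻¹ • (((1 - μ - ξ) • ω t • k t + (μ * ω t) • (z t - w) - g - e • z t) -
        (J (z t - w) + ω t • k t))) t := by
  refine ((J.hasFDerivAt.comp_hasDerivAt t (hz.sub_const w)).add (hω.smul hk)).congr_deriv ?_
  have hz'e : z' = θ⁻¹ • (k t - (z t - w)) := by
    rw [hkz, add_sub_cancel_left, smul_smul, inv_mul_cancel₀ hθ.ne', one_smul]
  have h1 : ω t * (θ * b) = θ⁻¹ := by rw [hωe]; field_simp
  rw [smul_sub (ω t), smul_smul (ω t) (θ * b), h1, hz'e, map_smul, map_sub]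
  module

/-! ### Asymptotics of the abstract flow -/

/-- A solution `z`, for `t > t₀`, of the primal-dual flow
`z'' + ((a + 1) / t ^ q) z' + β (∇φ(z) + J (z + (t ^ q / a) z') + (c / t ^ p) z) = 0` with `J` skew,
together with a zero `w` of the monotone operator `∇φ + J`. -/
structure IsTikhonovFlow {E : Type*} [NormedAddCommGroup E] [InnerProductSpace ℝ E]
    [CompleteSpace E] (φ : E → ℝ) (Φ : E → E) (J : E →L[ℝ] E) (a q p c t₀ : ℝ) (β β' : ℝ → ℝ)
    (z z' z'' : ℝ → E) (w : E) : Prop where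
  a_pos : 0 < a
  q_pos : 0 < q
  q_lt : q < 1
  p_pos : 0 < p
  c_pos : 0 < c
  t₀_pos : 0 < t₀
  convex : ConvexOn ℝ univ φ
  gradient : ∀ u, HasGradientAt φ (Φ u) u
  continuous_gradient : Continuous Φ
  skew : ∀ u, inner ℝ u (J u) = 0
  isMin : ∀ u, φ w ≤ φ u + inner ℝ (J w) u
  deriv_z : ∀ t, t₀ < t → HasDerivAt z (z' t) t
  deriv_z' : ∀ t, t₀ < t → HasDerivAt z' (z'' t) t
  ode : ∀ t, t₀ < t → z'' t + ((a + 1) / t ^ q) • z' t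
    + β t • (Φ (z t) + J (z t + (t ^ q / a) • z' t) + (c / t ^ p) • z t) = 0
  β_pos : ∀ t, t₀ < t → 0 < β t
  deriv_β : ∀ t, t₀ < t → HasDerivAt β (β' t) t
  β'_nonneg : ∀ t, t₀ < t → 0 ≤ β' t
  β'_le : ∀ t, t₀ < t → β' t * (t ^ q / a) ≤ β t
  tendsto_weight : Tendsto (fun t => (t ^ q / a) ^ 2 * β t * (c / t ^ p)) atTop atTop

namespace IsTikhonovFlow

variable {E : Type*} [NormedAddCommGroup E] [InnerProductSpace ℝ E] [CompleteSpace E]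
  {φ : E → ℝ} {Φ : E → E} {J : E →L[ℝ] E} {a q p c t₀ : ℝ} {β β' : ℝ → ℝ}
  {z z' z'' : ℝ → E} {w : E}

/-- The gap function `φ(u) - φ(w) + ⟨J w, u - w⟩`, where `⟨J w, w⟩ = 0`. -/
def gap (φ : E → ℝ) (J : E →L[ℝ] E) (w u : E) : ℝ := φ u - φ w + inner ℝ (J w) u

lemma gap_nonneg (h : IsTikhonovFlow φ Φ J a q p c t₀ β β' z z' z'' w) (u : E) :
    0 ≤ gap φ J w u := by
  have := h.isMin u
  unfold gap; linarith

lemma hasGradientAt_gap (h : IsTikhonovFlow φ Φ J a q p c t₀ β β' z z' z'' w) (u : E) :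
    HasGradientAt (gap φ J w) (Φ u + J w) u := by
  rw [hasGradientAt_iff_hasFDerivAt, map_add]
  exact ((h.gradient u).hasFDerivAt.sub_const _).add (innerSL ℝ (J w)).hasFDerivAt

lemma gap_le (h : IsTikhonovFlow φ Φ J a q p c t₀ β β' z z' z'' w) (u : E) :
    gap φ J w u ≤ inner ℝ (Φ u + J w) (u - w) := by
  have := h.convex.sub_le_inner_gradient (h.gradient u) w
  have h2 : inner ℝ (J w) w = 0 := by rw [real_inner_comm]; exact h.skew w
  rw [gap, inner_add_left, inner_sub_right (J w), h2]
  linarith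

lemma gradient_eq_zero (h : IsTikhonovFlow φ Φ J a q p c t₀ β β' z z' z'' w) {u : E}
    (hu : gap φ J w u = 0) : Φ u + J w = 0 := by
  have hmin : IsLocalMin (gap φ J w) u :=
    Filter.Eventually.of_forall fun v => hu ▸ h.gap_nonneg v
  have := hmin.hasFDerivAt_eq_zero (h.hasGradientAt_gap u).hasFDerivAt
  exact (LinearIsometryEquiv.map_eq_zero_iff _).1 this

lemma tendsto_rpow_sub_one (h : IsTikhonovFlow φ Φ J a q p c t₀ β β' z z' z'' w) :
    Tendsto (fun t : ℝ => t ^ (q - 1)) atTop (𝓝 0) := by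
  have := tendsto_rpow_neg_atTop (y := 1 - q) (by linarith [h.q_lt])
  simpa using this

lemma hasDerivAt_theta (h : IsTikhonovFlow φ Φ J a q p c t₀ β β' z z' z'' w) {t : ℝ}
    (ht : t₀ < t) : HasDerivAt (fun t : ℝ => t ^ q / a) (q * t ^ (q - 1) / a) t :=
  (Real.hasDerivAt_rpow_const (Or.inl (h.t₀_pos.trans ht).ne')).div_const a

lemma hasDerivAt_eps (h : IsTikhonovFlow φ Φ J a q p c t₀ β β' z z' z'' w) {t : ℝ}
    (ht : t₀ < t) : HasDerivAt (fun t : ℝ => c / t ^ p) (-(p / t) * (c / t ^ p)) t := by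
  have h0 := h.t₀_pos.trans ht
  have h1 := Real.rpow_pos_of_pos h0 p
  refine ((hasDerivAt_const t c).div (Real.hasDerivAt_rpow_const (p := p) (Or.inl h0.ne'))
    h1.ne').congr_deriv ?_
  rw [Real.rpow_sub_one h0.ne']
  field_simp
  ring

lemma hasDerivAt_shift (h : IsTikhonovFlow φ Φ J a q p c t₀ β β' z z' z'' w) {t : ℝ}
    (ht : t₀ < t) : HasDerivAt (fun s => z s - w + (s ^ q / a) • z' s)
      (-(1 / a - q * t ^ (q - 1) / a) • z' t - (t ^ q / a * β t) •
        (Φ (z t) + J w + (c / t ^ p) • z t + J (z t - w + (t ^ q / a) • z' t))) t := by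
  have h0 := h.t₀_pos.trans ht
  have h1 := Real.rpow_pos_of_pos h0 q
  have ha := h.a_pos
  refine hasDerivAt_shifted_velocity (δ := (a + 1) / t ^ q) (h.deriv_z t ht) (h.deriv_z' t ht)
    (h.hasDerivAt_theta ht) ?_ (h.ode t ht)
  field_simp

lemma eventually_lyapunov_le (h : IsTikhonovFlow φ Φ J a q p c t₀ β β' z z' z'' w) {σ δ : ℝ}
    (hσ : ∀ᶠ t in atTop, σ ≤ ‖z t‖ ^ 2) (hδ : 0 < δ) :
    ∀ᶠ t in atTop, gap φ J w (z t) / (c / t ^ p) + (‖z t‖ ^ 2 - σ) / 2 +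
      ‖z t - w + (t ^ q / a) • z' t‖ ^ 2 / (2 * ((t ^ q / a) ^ 2 * β t * (c / t ^ p))) ≤
      (‖w‖ ^ 2 - σ) / 2 / min (1 / 2) (1 / (4 * a)) + δ := by
  have ha := h.a_pos
  set κ := min (1 / 2) (1 / (4 * a)) with hκ
  have hκ0 : 0 < κ := lt_min (by norm_num) (by positivity)
  -- This is νθ < κ, with ν = p/t the logarithmic decay rate of ε.
  have e1 : ∀ᶠ t : ℝ in atTop, p / a * t ^ (q - 1) < κ := by
    have := h.tendsto_rpow_sub_one.const_mul (p / a)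
    rw [mul_zero] at this
    exact this.eventually (gt_mem_nhds hκ0)
  have e2 : ∀ᶠ t : ℝ in atTop, q * t ^ (q - 1) < 1 / 2 := by
    have := h.tendsto_rpow_sub_one.const_mul q
    rw [mul_zero] at this
    exact this.eventually (gt_mem_nhds (by norm_num))
  obtain ⟨T, hT⟩ := eventually_atTop.1 (hσ.and (e1.and (e2.and
    ((h.tendsto_weight.eventually_ge_atTop (1 / a)).and (eventually_gt_atTop t₀)))))
  have key : ∀ t, ∃ R', T ≤ t → HasDerivAt (fun t => gap φ J w (z t) / (c / t ^ p) +
      (‖z t‖ ^ 2 - σ) / 2 + ‖z t - w + (t ^ q / a) • z' t‖ ^ 2 /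
        (2 * ((t ^ q / a) ^ 2 * β t * (c / t ^ p)))) R' t ∧
      R' ≤ (-κ * (gap φ J w (z t) / (c / t ^ p) +
      (‖z t‖ ^ 2 - σ) / 2 + ‖z t - w + (t ^ q / a) • z' t‖ ^ 2 /
        (2 * ((t ^ q / a) ^ 2 * β t * (c / t ^ p)))) + (‖w‖ ^ 2 - σ) / 2) / (t ^ q / a) := by
    intro t
    by_cases ht : T ≤ t
    swap
    -- A dummy value below T, so that `choose` yields a total function.
    · exact ⟨0, fun h => absurd h ht⟩
    obtain ⟨h1, h2, h3, h4, h5⟩ := hT t ht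
    have h0 := h.t₀_pos.trans h5
    have hq := Real.rpow_pos_of_pos h0 q
    have hq1 := Real.rpow_pos_of_pos h0 (q - 1)
    have hp := Real.rpow_pos_of_pos h0 p
    have hc := h.c_pos
    have hβ := h.β_pos t h5
    have hβ' := h.β'_nonneg t h5
    have hq0 := h.q_pos
    have hQd := (((h.hasDerivAt_theta h5).pow 2).mul (h.deriv_β t h5)).mul (h.hasDerivAt_eps h5)
    have hμ1 : 1 / (2 * a) ≤ 1 / a - q * t ^ (q - 1) / a := by
      have h6 : q * t ^ (q - 1) / a ≤ 1 / 2 / a := by gcongr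
      have h7 : 1 / (2 * a) = 1 / a - 1 / 2 / a := by field_simp; norm_num
      linarith
    have hμ2 : 1 / a - q * t ^ (q - 1) / a ≤ 1 / a := by
      have : 0 ≤ q * t ^ (q - 1) / a := by positivity
      linarith
    have hν : p / t * (t ^ q / a) ≤ κ := by
      refine le_of_eq_of_le ?_ h2.le
      rw [Real.rpow_sub_one h0.ne']
      field_simp
    have hQ' : -(p / t) * ((t ^ q / a) ^ 2 * β t * (c / t ^ p)) ≤
        (2 * (t ^ q / a) * (q * t ^ (q - 1) / a) * β t + (t ^ q / a) ^ 2 * β' t) * (c / t ^ p) +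
          (t ^ q / a) ^ 2 * β t * (-(p / t) * (c / t ^ p)) := by
      have : 0 ≤ (2 * (t ^ q / a) * (q * t ^ (q - 1) / a) * β t + (t ^ q / a) ^ 2 * β' t) *
        (c / t ^ p) := by positivity
      linarith
    have hQd' : HasDerivAt (fun t => (t ^ q / a) ^ 2 * β t * (c / t ^ p)) _ t :=
      hQd.congr_deriv (by simp only [Pi.mul_apply, Pi.pow_apply]; push_cast; rw [pow_one])
    obtain ⟨R', hR⟩ := exists_hasDerivAt_lyapunov_le (θ := t ^ q / a) (b := β t) (ν := p / t)
      (μ := 1 / a - q * t ^ (q - 1) / a) (κ := κ) (σ := σ)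
      (Q := fun t => (t ^ q / a) ^ 2 * β t * (c / t ^ p)) ha (by positivity) (h.hasDerivAt_eps h5)
      (by positivity) (h.hasGradientAt_gap _) (h.gap_le _) (h.gap_nonneg _) (h.deriv_z t h5)
      (h.hasDerivAt_shift h5) rfl (h.skew _) hμ1 hμ2 hν (min_le_left _ _) (min_le_right _ _) rfl h4
      hQd' hQ' h1
    exact ⟨R', fun _ => hR⟩
  choose R' hR' using key
  exact eventually_le_of_deriv_le_div_rpow ha h.q_lt (h.t₀_pos.trans (hT T le_rfl).2.2.2.2) hκ0
    (fun t ht => (hR' t ht).1) (fun t ht => (hR' t ht).2) hδ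

lemma exists_bound (h : IsTikhonovFlow φ Φ J a q p c t₀ β β' z z' z'' w) :
    ∃ B, 0 < B ∧ ∀ᶠ t in atTop, gap φ J w (z t) ≤ B * (c / t ^ p) ∧ ‖z t‖ ^ 2 ≤ 2 * B ∧
      ‖z t - w + (t ^ q / a) • z' t‖ ^ 2 ≤ 2 * B * ((t ^ q / a) ^ 2 * β t * (c / t ^ p)) := by
  have ha := h.a_pos
  have hc := h.c_pos
  refine ⟨(‖w‖ ^ 2 - 0) / 2 / min (1 / 2) (1 / (4 * a)) + 1, ?_, ?_⟩
  · have : 0 < min (1 / 2) (1 / (4 * a)) := lt_min (by norm_num) (by positivity)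
    rw [sub_zero]; positivity
  filter_upwards [h.eventually_lyapunov_le (σ := 0) (Eventually.of_forall fun t => by positivity)
    one_pos, eventually_gt_atTop t₀] with t h1 h2
  have h0 := h.t₀_pos.trans h2
  have hp := Real.rpow_pos_of_pos h0 p
  have hq := Real.rpow_pos_of_pos h0 q
  have hβ := h.β_pos t h2
  rw [sub_zero (‖z t‖ ^ 2)] at h1
  generalize (‖w‖ ^ 2 - 0) / 2 / min (1 / 2) (1 / (4 * a)) + 1 = B at *
  have g0 := h.gap_nonneg (z t)
  have g1 : 0 ≤ gap φ J w (z t) / (c / t ^ p) := by positivity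
  have g2 : 0 ≤ ‖z t‖ ^ 2 / 2 := by positivity
  have g3 : 0 ≤ ‖z t - w + (t ^ q / a) • z' t‖ ^ 2 /
    (2 * ((t ^ q / a) ^ 2 * β t * (c / t ^ p))) := by positivity
  refine ⟨?_, by linarith, ?_⟩
  · rw [← div_le_iff₀ (by positivity)]; linarith
  · have : ‖z t - w + (t ^ q / a) • z' t‖ ^ 2 /
      (2 * ((t ^ q / a) ^ 2 * β t * (c / t ^ p))) ≤ B := by linarith
    rw [div_le_iff₀ (by positivity)] at this
    linarith

lemma tendsto_eps (h : IsTikhonovFlow φ Φ J a q p c t₀ β β' z z' z'' w) :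
    Tendsto (fun t : ℝ => c / t ^ p) atTop (𝓝 0) :=
  tendsto_const_nhds.div_atTop (tendsto_rpow_atTop h.p_pos)

lemma tendsto_gap (h : IsTikhonovFlow φ Φ J a q p c t₀ β β' z z' z'' w) :
    Tendsto (fun t => gap φ J w (z t)) atTop (𝓝 0) := by
  obtain ⟨B, -, hB⟩ := h.exists_bound
  refine squeeze_zero' (Eventually.of_forall fun t => h.gap_nonneg _)
    (hB.mono fun t ht => ht.1) ?_
  simpa using h.tendsto_eps.const_mul B

lemma continuous_gap (h : IsTikhonovFlow φ Φ J a q p c t₀ β β' z z' z'' w) :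
    Continuous (gap φ J w) :=
  continuous_iff_continuousAt.2 fun u => (h.hasGradientAt_gap u).hasFDerivAt.continuousAt

lemma exists_tendsto_ultrafilter [ProperSpace E]
    (h : IsTikhonovFlow φ Φ J a q p c t₀ β β' z z' z'' w) (U : Ultrafilter ℝ)
    (hU : (U : Filter ℝ) ≤ atTop) : ∃ u, Tendsto z U (𝓝 u) ∧ gap φ J w u = 0 := by
  obtain ⟨B, hB0, hB⟩ := h.exists_bound
  have hmem : ∀ᶠ t in (U : Filter ℝ), z t ∈ Metric.closedBall (0 : E) (√(2 * B)) := by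
    filter_upwards [hU hB] with t ht
    rw [mem_closedBall_zero_iff]
    exact Real.le_sqrt_of_sq_le ht.2.1
  obtain ⟨u, -, hu⟩ := (isCompact_closedBall (0 : E) (√(2 * B))).ultrafilter_le_nhds (U.map z)
    (le_principal_iff.2 hmem)
  refine ⟨u, hu, tendsto_nhds_unique ((h.continuous_gap.tendsto u).comp hu) ?_⟩
  exact h.tendsto_gap.mono_left hU

/-- Zeros of the gap are its minimisers, so its gradient vanishes at every cluster point of the
bounded trajectory. -/
lemma tendsto_gradient [ProperSpace E] (h : IsTikhonovFlow φ Φ J a q p c t₀ β β' z z' z'' w) :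
    Tendsto (fun t => Φ (z t) + J w) atTop (𝓝 0) := by
  rw [tendsto_iff_ultrafilter]
  intro U hU
  obtain ⟨u, hu, hu0⟩ := h.exists_tendsto_ultrafilter U hU
  rw [← h.gradient_eq_zero hu0]
  exact ((h.continuous_gradient.tendsto u).comp hu).add_const _

lemma tendsto_inv_weight (h : IsTikhonovFlow φ Φ J a q p c t₀ β β' z z' z'' w) :
    Tendsto (fun t => ((t ^ q / a) ^ 2 * β t)⁻¹) atTop (𝓝 0) := by
  refine (h.tendsto_eps.div_atTop h.tendsto_weight).congr' ?_
  filter_upwards [eventually_gt_atTop t₀] with t ht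
  have hp := Real.rpow_pos_of_pos (h.t₀_pos.trans ht) p
  have hc := h.c_pos
  field_simp

/-- With ω = 1/(θ²β), the energy bound ‖k‖² ≤ 2Bθ²βε gives ‖ωk‖² ≤ 2Bεω. -/
lemma tendsto_inv_weight_smul_shift (h : IsTikhonovFlow φ Φ J a q p c t₀ β β' z z' z'' w) :
    Tendsto (fun t => ((t ^ q / a) ^ 2 * β t)⁻¹ • (z t - w + (t ^ q / a) • z' t)) atTop (𝓝 0) := by
  obtain ⟨B, hB0, hB⟩ := h.exists_bound
  have hlim : Tendsto (fun t => √(2 * B * ((c / t ^ p) * ((t ^ q / a) ^ 2 * β t)⁻¹))) atTop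
      (𝓝 0) := by
    have := ((h.tendsto_eps.mul h.tendsto_inv_weight).const_mul (2 * B)).sqrt
    simpa using this
  refine squeeze_zero_norm' ?_ hlim
  filter_upwards [hB, eventually_gt_atTop t₀] with t ht ht0
  have hβ := h.β_pos t ht0
  have hq := Real.rpow_pos_of_pos (h.t₀_pos.trans ht0) q
  have ha := h.a_pos
  apply Real.le_sqrt_of_sq_le
  rw [norm_smul, mul_pow, Real.norm_of_nonneg (by positivity)]
  refine (mul_le_mul_of_nonneg_left ht.2.2 (by positivity)).trans_eq ?_
  field_simp

/-- V = J(z - w) + ωk satisfies θV' = r - V, where r → 0 because ωk, ω, the gap gradient and ε all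
vanish while z stays bounded. Hence V → 0, and ωk → 0 is subtracted. -/
lemma tendsto_coupling [ProperSpace E] (h : IsTikhonovFlow φ Φ J a q p c t₀ β β' z z' z'' w) :
    Tendsto (fun t => J (z t - w)) atTop (𝓝 0) := by
  have ha := h.a_pos
  obtain ⟨B, hB0, hB⟩ := h.exists_bound
  have hzb : ∀ᶠ t in atTop, ‖z t‖ ≤ √(2 * B) := hB.mono fun t ht => Real.le_sqrt_of_sq_le ht.2.1
  have e2 : ∀ᶠ t : ℝ in atTop, q * t ^ (q - 1) < 1 / 2 := by
    have := h.tendsto_rpow_sub_one.const_mul q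
    rw [mul_zero] at this
    exact this.eventually (gt_mem_nhds (by norm_num))
  set ω : ℝ → ℝ := fun t => ((t ^ q / a) ^ 2 * β t)⁻¹ with hω
  set k : ℝ → E := fun t => z t - w + (t ^ q / a) • z' t with hk
  set μ : ℝ → ℝ := fun t => 1 / a - q * t ^ (q - 1) / a with hμ
  set ξ : ℝ → ℝ := fun t => 2 * (q * t ^ (q - 1) / a) + β' t * (t ^ q / a) / β t with hξ
  have hω0 : Tendsto ω atTop (𝓝 0) := h.tendsto_inv_weight
  have hωk : Tendsto (fun t => ω t • k t) atTop (𝓝 0) := h.tendsto_inv_weight_smul_shift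
  have hV : Tendsto (fun t => J (z t - w) + ω t • k t) atTop (𝓝 0) := by
    refine tendsto_zero_of_deriv_eq_div_rpow (a := a) (q := q) (V' := fun t =>
      (t ^ q / a)⁻¹ • (((1 - μ t - ξ t) • ω t • k t + (μ t * ω t) • (z t - w) - (Φ (z t) + J w)
        - (c / t ^ p) • z t) - (J (z t - w) + ω t • k t))) ha h.q_lt ?_
      (Eventually.of_forall fun t => rfl) ?_
    · filter_upwards [eventually_gt_atTop t₀] with t ht
      have h0 := h.t₀_pos.trans ht
      have hq := Real.rpow_pos_of_pos h0 q
      have hβ := h.β_pos t ht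
      refine hasDerivAt_coupling (b := β t) (by positivity) hβ (h.deriv_z t ht) ?_ rfl
        (h.hasDerivAt_shift ht) rfl
      refine ((((h.hasDerivAt_theta ht).pow 2).mul (h.deriv_β t ht)).inv
        (by simp only [Pi.mul_apply, Pi.pow_apply]; positivity)).congr_deriv ?_
      simp only [Pi.mul_apply, Pi.pow_apply, hξ, hω]
      push_cast
      generalize q * t ^ (q - 1) / a = θ'
      field_simp
    · have hlim : Tendsto (fun t => (3 + 2 / a) * ‖ω t • k t‖ + 1 / a * ω t * (√(2 * B) + ‖w‖) +
          ‖Φ (z t) + J w‖ + c / t ^ p * √(2 * B)) atTop (𝓝 0) := by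
        have := (((hωk.norm.const_mul (3 + 2 / a)).add
          ((hω0.const_mul (1 / a)).mul_const (√(2 * B) + ‖w‖))).add
          h.tendsto_gradient.norm).add (h.tendsto_eps.mul_const √(2 * B))
        simpa using this
      refine squeeze_zero_norm' ?_ hlim
      filter_upwards [hzb, e2, eventually_gt_atTop t₀] with t h1 h2 ht
      have h0 := h.t₀_pos.trans ht
      have hq := Real.rpow_pos_of_pos h0 q
      have hq1 := Real.rpow_pos_of_pos h0 (q - 1)
      have hp := Real.rpow_pos_of_pos h0 p
      have hc := h.c_pos
      have hq0 := h.q_pos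
      have hβ := h.β_pos t ht
      have hβ' := h.β'_nonneg t ht
      have hω0 : 0 ≤ ω t := by simp only [hω]; positivity
      have hθ'0 : 0 ≤ q * t ^ (q - 1) / a := by positivity
      have hθ'1 : q * t ^ (q - 1) / a ≤ 1 / 2 * (1 / a) := by
        rw [mul_one_div]; gcongr
      have hξ0 : 0 ≤ β' t * (t ^ q / a) / β t := by positivity
      have hξ1 : β' t * (t ^ q / a) / β t ≤ 1 := (div_le_one hβ).2 (h.β'_le t ht)
      have ha1 : 0 ≤ 1 / a := by positivity
      have hμ0 : 0 ≤ μ t := by simp only [hμ]; linarith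
      have hμ1 : μ t ≤ 1 / a := by simp only [hμ]; linarith
      -- A crude bound: 0 ≤ μ ≤ 1/a and 0 ≤ ξ ≤ 1/a + 1, the final 1 coming from β'θ ≤ β.
      have hcoef : |1 - μ t - ξ t| ≤ 3 + 2 / a := by
        have : 2 / a = 2 * (1 / a) := by ring
        rw [abs_le]
        simp only [hμ, hξ]
        constructor <;> linarith
      have n1 : ‖(1 - μ t - ξ t) • ω t • k t‖ ≤ (3 + 2 / a) * ‖ω t • k t‖ := by
        rw [norm_smul (1 - μ t - ξ t), Real.norm_eq_abs]; gcongr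
      have n2 : ‖(μ t * ω t) • (z t - w)‖ ≤ 1 / a * ω t * (√(2 * B) + ‖w‖) := by
        rw [norm_smul, Real.norm_of_nonneg (by positivity)]
        have := norm_sub_le (z t) w
        gcongr
        linarith
      have n3 : ‖(c / t ^ p) • z t‖ ≤ c / t ^ p * √(2 * B) := by
        rw [norm_smul, Real.norm_of_nonneg (by positivity)]; gcongr
      refine (norm_sub_le _ _).trans (add_le_add ((norm_sub_le _ _).trans (add_le_add
        ((norm_add_le _ _).trans (add_le_add n1 n2)) le_rfl)) n3)
  simpa using hV.sub hωk

lemma exists_tendsto_ultrafilter_coupling [ProperSpace E]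
    (h : IsTikhonovFlow φ Φ J a q p c t₀ β β' z z' z'' w) (U : Ultrafilter ℝ)
    (hU : (U : Filter ℝ) ≤ atTop) : ∃ u, Tendsto z U (𝓝 u) ∧ gap φ J w u = 0 ∧ J u = J w := by
  obtain ⟨u, hu, hu0⟩ := h.exists_tendsto_ultrafilter U hU
  refine ⟨u, hu, hu0, ?_⟩
  have h1 : Tendsto (fun t => J (z t - w)) U (𝓝 (J (u - w))) :=
    ((J.continuous.tendsto _).comp (hu.sub_const w))
  have := tendsto_nhds_unique h1 (h.tendsto_coupling.mono_left hU)
  rwa [map_sub, sub_eq_zero] at this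

/-- Every cluster point along `l` meets the three conditions in `hw`, so it is w. -/
lemma tendsto_of_limsup_norm_le [ProperSpace E]
    (h : IsTikhonovFlow φ Φ J a q p c t₀ β β' z z' z'' w)
    (hw : ∀ u, gap φ J w u = 0 → J u = J w → ‖u‖ ≤ ‖w‖ → u = w) {l : Filter ℝ} (hl : l ≤ atTop)
    (hz : ∀ δ > 0, ∀ᶠ t in l, ‖z t‖ ^ 2 ≤ ‖w‖ ^ 2 + δ) : Tendsto z l (𝓝 w) := by
  rw [tendsto_iff_ultrafilter]
  intro U hU
  obtain ⟨u, hu, hu0, huJ⟩ := h.exists_tendsto_ultrafilter_coupling U (hU.trans hl)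
  have hle : ‖u‖ ^ 2 ≤ ‖w‖ ^ 2 := le_of_forall_pos_le_add fun δ hδ =>
    le_of_tendsto (hu.norm.pow 2) (hU (hz δ hδ))
  rwa [← hw u hu0 huJ (le_of_sq_le_sq hle (norm_nonneg _))]

lemma tendsto_of_norm_ge [ProperSpace E]
    (h : IsTikhonovFlow φ Φ J a q p c t₀ β β' z z' z'' w)
    (hw : ∀ u, gap φ J w u = 0 → J u = J w → ‖u‖ ≤ ‖w‖ → u = w)
    (hz : ∀ᶠ t in atTop, ‖w‖ ≤ ‖z t‖) : Tendsto z atTop (𝓝 w) := by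
  refine h.tendsto_of_limsup_norm_le hw le_rfl fun δ hδ => ?_
  -- This σ removes the source term, so the whole energy is eventually below δ/2.
  filter_upwards [h.eventually_lyapunov_le (σ := ‖w‖ ^ 2) (hz.mono fun t ht => by gcongr)
    (half_pos hδ), eventually_gt_atTop t₀] with t h1 h2
  have h0 := h.t₀_pos.trans h2
  have hp := Real.rpow_pos_of_pos h0 p
  have hq := Real.rpow_pos_of_pos h0 q
  have hβ := h.β_pos t h2
  have ha := h.a_pos
  have hc := h.c_pos
  have g0 := h.gap_nonneg (z t)
  have g1 : 0 ≤ gap φ J w (z t) / (c / t ^ p) := by positivity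
  have g3 : 0 ≤ ‖z t - w + (t ^ q / a) • z' t‖ ^ 2 /
    (2 * ((t ^ q / a) ^ 2 * β t * (c / t ^ p))) := by positivity
  rw [sub_self, zero_div, zero_div, zero_add] at h1
  linarith

lemma tendsto_of_norm_le [ProperSpace E]
    (h : IsTikhonovFlow φ Φ J a q p c t₀ β β' z z' z'' w)
    (hw : ∀ u, gap φ J w u = 0 → J u = J w → ‖u‖ ≤ ‖w‖ → u = w) {l : Filter ℝ} (hl : l ≤ atTop)
    (hz : ∀ᶠ t in l, ‖z t‖ ≤ ‖w‖) : Tendsto z l (𝓝 w) :=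
  h.tendsto_of_limsup_norm_le hw hl fun δ hδ => hz.mono fun t ht => by
    have : ‖z t‖ ^ 2 ≤ ‖w‖ ^ 2 := by gcongr
    linarith

lemma exists_tendsto [ProperSpace E]
    (h : IsTikhonovFlow φ Φ J a q p c t₀ β β' z z' z'' w)
    (hw : ∀ u, gap φ J w u = 0 → J u = J w → ‖u‖ ≤ ‖w‖ → u = w) :
    ∃ l : Filter ℝ, l.NeBot ∧ l ≤ atTop ∧ Tendsto z l (𝓝 w) := by
  -- Either restrict to the times spent in the closed ball, or z is eventually outside it.
  by_cases hf : ∃ᶠ t in atTop, ‖z t‖ ≤ ‖w‖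
  · exact ⟨atTop ⊓ 𝓟 {t | ‖z t‖ ≤ ‖w‖}, frequently_mem_iff_neBot.1 hf, inf_le_left,
      h.tendsto_of_norm_le hw inf_le_left (eventually_inf_principal.2 (Eventually.of_forall
        fun _ => id))⟩
  · rw [not_frequently] at hf
    exact ⟨atTop, atTop_neBot, le_rfl,
      h.tendsto_of_norm_ge hw (hf.mono fun t ht => (not_le.1 ht).le)⟩

end IsTikhonovFlow

/-! ### The minimal norm element of a closed convex set -/

lemma exists_projZero_eq_singleton {E : Type*} [NormedAddCommGroup E] [InnerProductSpace ℝ E]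
    [CompleteSpace E] {D : Set E} (hne : D.Nonempty) (hcl : IsClosed D) (hc : Convex ℝ D) :
    ∃ w ∈ D, projZero D = {w} ∧ ∀ u ∈ D, ‖u‖ ≤ ‖w‖ → u = w := by
  obtain ⟨w, hwD, hw⟩ := exists_norm_eq_iInf_of_complete_convex hne hcl.isComplete hc 0
  have h1 := (norm_eq_iInf_iff_real_inner_le_zero hc hwD).1 hw
  have h2 : ∀ u ∈ D, ‖w‖ ^ 2 + ‖u - w‖ ^ 2 ≤ ‖u‖ ^ 2 := by
    intro u hu
    have h3 := h1 u hu
    rw [zero_sub, inner_neg_left] at h3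
    have h4 : ‖u‖ ^ 2 = ‖w + (u - w)‖ ^ 2 := by rw [add_sub_cancel]
    rw [h4, norm_add_sq_real]
    linarith
  have h3 : ∀ u ∈ D, ‖u‖ ≤ ‖w‖ → u = w := by
    intro u hu hle
    have h4 := h2 u hu
    have h5 : ‖u‖ ^ 2 ≤ ‖w‖ ^ 2 := by gcongr
    have h6 : ‖u - w‖ ^ 2 = 0 := le_antisymm (by linarith) (by positivity)
    rwa [sq_eq_zero_iff, norm_eq_zero, sub_eq_zero] at h6
  refine ⟨w, hwD, ?_, h3⟩
  refine Set.eq_singleton_iff_unique_mem.2 ⟨⟨hwD, fun u hu => ?_⟩, fun u hu => h3 u hu.1 (hu.2 w hwD)⟩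
  refine le_of_sq_le_sq ?_ (norm_nonneg _)
  have := h2 u hu
  nlinarith [sq_nonneg ‖u - w‖]

lemma hasDerivAt_toLp_prod {X Y : Type*} [NormedAddCommGroup X] [NormedSpace ℝ X]
    [NormedAddCommGroup Y] [NormedSpace ℝ Y] {x : ℝ → X} {y : ℝ → Y} {x' : X} {y' : Y} {t : ℝ}
    (hx : HasDerivAt x x' t) (hy : HasDerivAt y y' t) :
    HasDerivAt (fun s => WithLp.toLp 2 (x s, y s)) (WithLp.toLp 2 (x', y')) t :=
  (WithLp.prodContinuousLinearEquiv 2 ℝ X Y).symm.hasFDerivAt.comp_hasDerivAt t (hx.prodMk hy)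

/-! ### Saddle points and the primal-dual system in product form -/

section Coupling

variable {n m : ℕ}

/-- The skew-adjoint operator `(x, y) ↦ (K* y, -K x)`. -/
noncomputable def skewCoupling (K : EuclideanSpace ℝ (Fin n) →L[ℝ] EuclideanSpace ℝ (Fin m)) :
    WithLp 2 (EuclideanSpace ℝ (Fin n) × EuclideanSpace ℝ (Fin m)) →L[ℝ]
      WithLp 2 (EuclideanSpace ℝ (Fin n) × EuclideanSpace ℝ (Fin m)) :=
  ((WithLp.prodContinuousLinearEquiv 2 ℝ (EuclideanSpace ℝ (Fin n))
    (EuclideanSpace ℝ (Fin m))).symm : _ →L[ℝ] _).comp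
  (((ContinuousLinearMap.adjoint K).comp (WithLp.sndL 2 ℝ _ _)).prod
    (-(K.comp (WithLp.fstL 2 ℝ _ _))))

variable (f : EuclideanSpace ℝ (Fin n) → ℝ) (g : EuclideanSpace ℝ (Fin m) → ℝ)
  (K : EuclideanSpace ℝ (Fin n) →L[ℝ] EuclideanSpace ℝ (Fin m))

/-- The separable function `(x, y) ↦ f x + g y`. -/
def sepSum (u : WithLp 2 (EuclideanSpace ℝ (Fin n) × EuclideanSpace ℝ (Fin m))) : ℝ :=
  f u.fst + g u.snd

/-- The gradient of `(x, y) ↦ f x + g y`. -/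
noncomputable def sepGradient
    (u : WithLp 2 (EuclideanSpace ℝ (Fin n) × EuclideanSpace ℝ (Fin m))) :
    WithLp 2 (EuclideanSpace ℝ (Fin n) × EuclideanSpace ℝ (Fin m)) :=
  WithLp.toLp 2 (gradient f u.fst, gradient g u.snd)

lemma skewCoupling_apply (u : WithLp 2 (EuclideanSpace ℝ (Fin n) × EuclideanSpace ℝ (Fin m))) :
    skewCoupling K u = WithLp.toLp 2 (ContinuousLinearMap.adjoint K u.snd, -(K u.fst)) := rfl

lemma inner_skewCoupling (u v : WithLp 2 (EuclideanSpace ℝ (Fin n) × EuclideanSpace ℝ (Fin m))) :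
    inner ℝ (skewCoupling K u) v = inner ℝ (K v.fst) u.snd - inner ℝ (K u.fst) v.snd := by
  rw [WithLp.prod_inner_apply, skewCoupling_apply]
  change inner ℝ (ContinuousLinearMap.adjoint K u.snd) v.fst + inner ℝ (-(K u.fst)) v.snd = _
  rw [ContinuousLinearMap.adjoint_inner_left, inner_neg_left, real_inner_comm, sub_eq_add_neg]

lemma inner_skewCoupling_self
    (u : WithLp 2 (EuclideanSpace ℝ (Fin n) × EuclideanSpace ℝ (Fin m))) :
    inner ℝ u (skewCoupling K u) = 0 := by
  rw [real_inner_comm, inner_skewCoupling, sub_self]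

variable {f g}

/-- The two saddle inequalities add up to this one; conversely, take v sharing one component with u.
-/
lemma mem_saddleSet_iff {u : WithLp 2 (EuclideanSpace ℝ (Fin n) × EuclideanSpace ℝ (Fin m))} :
    u ∈ saddleSet (lagrangian f g K) ↔
      ∀ v, sepSum f g u ≤ sepSum f g v + inner ℝ (skewCoupling K u) v := by
  simp only [saddleSet, mem_ofPred_eq, lagrangian, inner_skewCoupling, sepSum]
  constructor
  · intro h v
    have := h v.fst v.snd
    linarith
  · intro h x y
    have h1 := h (WithLp.toLp 2 (u.fst, y))
    have h2 := h (WithLp.toLp 2 (x, u.snd))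
    simp only [WithLp.toLp_fst, WithLp.toLp_snd] at h1 h2
    constructor <;> linarith

lemma convexOn_sepSum (hf : ConvexOn ℝ univ f) (hg : ConvexOn ℝ univ g) :
    ConvexOn ℝ univ (sepSum f g) :=
  (hf.comp_linearMap (WithLp.fstL 2 ℝ (EuclideanSpace ℝ (Fin n))
    (EuclideanSpace ℝ (Fin m))).toLinearMap).add
  (hg.comp_linearMap (WithLp.sndL 2 ℝ (EuclideanSpace ℝ (Fin n))
    (EuclideanSpace ℝ (Fin m))).toLinearMap)

lemma hasGradientAt_sepSum (hf : Differentiable ℝ f) (hg : Differentiable ℝ g)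
    (u : WithLp 2 (EuclideanSpace ℝ (Fin n) × EuclideanSpace ℝ (Fin m))) :
    HasGradientAt (sepSum f g) (sepGradient f g u) u := by
  have h1 := (hf u.fst).hasGradientAt.hasFDerivAt.comp u
    (WithLp.fstL 2 ℝ (EuclideanSpace ℝ (Fin n)) (EuclideanSpace ℝ (Fin m))).hasFDerivAt
  have h2 := (hg u.snd).hasGradientAt.hasFDerivAt.comp u
    (WithLp.sndL 2 ℝ (EuclideanSpace ℝ (Fin n)) (EuclideanSpace ℝ (Fin m))).hasFDerivAt
  rw [hasGradientAt_iff_hasFDerivAt]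
  refine (h1.add h2).congr_fderiv ?_
  ext v
  simp [WithLp.prod_inner_apply, sepGradient]

lemma continuous_gradient_of_contDiff {E : Type*} [NormedAddCommGroup E] [InnerProductSpace ℝ E]
    [CompleteSpace E] {φ : E → ℝ} (hφ : ContDiff ℝ 1 φ) : Continuous (gradient φ) :=
  (InnerProductSpace.toDual ℝ E).symm.continuous.comp (hφ.continuous_fderiv one_ne_zero)

lemma continuous_sepGradient (hf : ContDiff ℝ 1 f) (hg : ContDiff ℝ 1 g) :
    Continuous (sepGradient f g) :=
  (WithLp.prodContinuousLinearEquiv 2 ℝ _ _).symm.continuous.comp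
    (((continuous_gradient_of_contDiff hf).comp (WithLp.fstL 2 ℝ _ _).continuous).prodMk
      ((continuous_gradient_of_contDiff hg).comp (WithLp.sndL 2 ℝ _ _).continuous))

/-- Skewness turns ⟨J u, v⟩ into -⟨J v, u⟩. Each condition then becomes a sublevel set of a convex
function of u, which gives closedness and convexity. -/
lemma saddleSet_eq_iInter : saddleSet (lagrangian f g K) =
    ⋂ v, {u | sepSum f g u + inner ℝ (skewCoupling K v) u ≤ sepSum f g v} := by
  ext u
  rw [mem_saddleSet_iff, mem_iInter]
  refine forall_congr' fun v => ?_
  rw [mem_ofPred_eq, inner_skewCoupling, inner_skewCoupling]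
  constructor <;> intro h <;> linarith

lemma isClosed_saddleSet (hf : Continuous f) (hg : Continuous g) :
    IsClosed (saddleSet (lagrangian f g K)) := by
  rw [saddleSet_eq_iInter]
  refine isClosed_iInter fun v => isClosed_le ?_ continuous_const
  exact ((hf.comp (WithLp.fstL 2 ℝ _ _).continuous).add
    (hg.comp (WithLp.sndL 2 ℝ _ _).continuous)).add (innerSL ℝ (skewCoupling K v)).continuous

lemma convex_saddleSet (hf : ConvexOn ℝ univ f) (hg : ConvexOn ℝ univ g) :
    Convex ℝ (saddleSet (lagrangian f g K)) := by
  rw [saddleSet_eq_iInter]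
  refine convex_iInter fun v => ?_
  have := ((convexOn_sepSum hf hg).add
    ((innerSL ℝ (skewCoupling K v)).toLinearMap.convexOn convex_univ)).convex_le (sepSum f g v)
  simpa using this

lemma gradFst_lagrangian (hf : Differentiable ℝ f) (x : EuclideanSpace ℝ (Fin n))
    (y : EuclideanSpace ℝ (Fin m)) :
    gradFst (lagrangian f g K) x y = gradient f x + ContinuousLinearMap.adjoint K y := by
  apply HasGradientAt.gradient
  rw [hasGradientAt_iff_hasFDerivAt, map_add]
  have h1 := (hf x).hasGradientAt.hasFDerivAt.add
    (innerSL ℝ (ContinuousLinearMap.adjoint K y)).hasFDerivAt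
  refine (h1.sub_const (g y)).congr_of_eventuallyEq (Eventually.of_forall fun u => ?_)
  simp [lagrangian, ContinuousLinearMap.adjoint_inner_left, real_inner_comm]

lemma gradSnd_lagrangian (hg : Differentiable ℝ g) (x : EuclideanSpace ℝ (Fin n))
    (y : EuclideanSpace ℝ (Fin m)) :
    gradSnd (lagrangian f g K) x y = K x - gradient g y := by
  apply HasGradientAt.gradient
  rw [hasGradientAt_iff_hasFDerivAt, map_sub]
  have h1 := (innerSL ℝ (K x)).hasFDerivAt.sub (hg y).hasGradientAt.hasFDerivAt
  refine (h1.const_add (f x)).congr_of_eventuallyEq (Eventually.of_forall fun u => ?_)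
  simp [lagrangian, add_sub_assoc]

lemma flow_equation_toLp (hf : Differentiable ℝ f) (hg : Differentiable ℝ g)
    {x x' x'' : EuclideanSpace ℝ (Fin n)} {y y' y'' : EuclideanSpace ℝ (Fin m)} {δ θ b e : ℝ}
    (h1 : x'' + δ • x' + b • (gradFst (lagrangian f g K) x (y + θ • y') + e • x) = 0)
    (h2 : y'' + δ • y' - b • (gradSnd (lagrangian f g K) (x + θ • x') y - e • y) = 0) :
    WithLp.toLp 2 (x'', y'') + δ • WithLp.toLp 2 (x', y') +
      b • (sepGradient f g (WithLp.toLp 2 (x, y)) + skewCoupling K (WithLp.toLp 2 (x, y) +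
        θ • WithLp.toLp 2 (x', y')) + e • WithLp.toLp 2 (x, y)) = 0 := by
  rw [gradFst_lagrangian K hf] at h1
  rw [gradSnd_lagrangian K hg] at h2
  have h2' : y'' + δ • y' + b • (gradient g y + -(K (x + θ • x')) + e • y) = 0 := by
    rw [← h2]; module
  apply (WithLp.equiv 2 _).injective
  exact Prod.ext h1 h2'

end Coupling

/-! ### The main theorem -/

theorem theorem4p1 {n m : ℕ}
    (f : EuclideanSpace ℝ (Fin n) → ℝ) (g : EuclideanSpace ℝ (Fin m) → ℝ)
    (K : EuclideanSpace ℝ (Fin n) →L[ℝ] EuclideanSpace ℝ (Fin m))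
    (hf : ContDiff ℝ 1 f) (hf_conv : ConvexOn ℝ univ f)
    (hg : ContDiff ℝ 1 g) (hg_conv : ConvexOn ℝ univ g)
    (hΩ : (saddleSet (lagrangian f g K)).Nonempty)
    (α q p c t₀ : ℝ) (hα : 1 < α) (hq0 : 0 < q) (hq1 : q < 1) (hp : 0 < p) (hc : 0 < c)
    (ht₀ : 0 < t₀)
    (β : ℝ → ℝ) (hβ_pos : ∀ t, t₀ ≤ t → 0 < β t)
    (hβ_diff : ContDiffOn ℝ 1 β (Ici t₀)) (hβ_mono : MonotoneOn β (Ici t₀))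
    (hM : ∃ M : ℝ, 0 < M ∧ M ≤ q * (1 + 1 / (2 * α - 1)) ∧
      (∀ t, t₀ ≤ t → derivWithin β (Ici t₀) t / β t ≤ (α - 1) / t ^ q - M / t) ∧
      Tendsto (fun t : ℝ => t ^ (M - p) * β t) atTop atTop)
    (hint : IntegrableOn (fun t : ℝ => t ^ (-q - p) * β t) (Ici t₀))
    (x : ℝ → EuclideanSpace ℝ (Fin n)) (y : ℝ → EuclideanSpace ℝ (Fin m))
    (hsol : IsGlobalSolution (lagrangian f g K) α q p c t₀ β x y) :
    ∃ z : WithLp 2 (EuclideanSpace ℝ (Fin n) × EuclideanSpace ℝ (Fin m)),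
      projZero (saddleSet (lagrangian f g K)) = {z} ∧
      liminf (fun t : ℝ => ((‖WithLp.toLp 2 (x t, y t) - z‖ : ℝ) : EReal)) atTop = 0 ∧
      ((∃ T : ℝ, t₀ ≤ T ∧
          ((∀ t, T ≤ t → WithLp.toLp 2 (x t, y t) ∈ Metric.ball 0 ‖z‖) ∨
           (∀ t, T ≤ t → WithLp.toLp 2 (x t, y t) ∈ (Metric.ball 0 ‖z‖)ᶜ))) →
        Tendsto (fun t : ℝ => ‖WithLp.toLp 2 (x t, y t) - z‖) atTop (𝓝 0)) := by
  have hfd := hf.differentiable one_ne_zero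
  have hgd := hg.differentiable one_ne_zero
  obtain ⟨w, hwΩ, hproj, huniq⟩ := exists_projZero_eq_singleton hΩ
    (isClosed_saddleSet K hf.continuous hg.continuous) (convex_saddleSet K hf_conv hg_conv)
  obtain ⟨M, hM0, hMq, hβ', hlim⟩ := hM
  obtain ⟨x', x'', y', y'', hs⟩ := hsol
  have ha : 0 < α - 1 := by linarith
  have hflow : IsTikhonovFlow (sepSum f g) (sepGradient f g) (skewCoupling K) (α - 1) q p c t₀ β
      (derivWithin β (Ici t₀)) (fun t => WithLp.toLp 2 (x t, y t))
      (fun t => WithLp.toLp 2 (x' t, y' t)) (fun t => WithLp.toLp 2 (x'' t, y'' t)) w :=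
    { a_pos := ha
      q_pos := hq0
      q_lt := hq1
      p_pos := hp
      c_pos := hc
      t₀_pos := ht₀
      convex := convexOn_sepSum hf_conv hg_conv
      gradient := hasGradientAt_sepSum hfd hgd
      continuous_gradient := continuous_sepGradient hf hg
      skew := inner_skewCoupling_self K
      isMin := (mem_saddleSet_iff K).1 hwΩ
      deriv_z := fun t ht => hasDerivAt_toLp_prod ((hs t ht.le).1.hasDerivAt (Ici_mem_nhds ht))
        ((hs t ht.le).2.2.1.hasDerivAt (Ici_mem_nhds ht))
      deriv_z' := fun t ht => hasDerivAt_toLp_prod ((hs t ht.le).2.1.hasDerivAt (Ici_mem_nhds ht))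
        ((hs t ht.le).2.2.2.1.hasDerivAt (Ici_mem_nhds ht))
      ode := fun t ht => by
        have := flow_equation_toLp K hfd hgd (hs t ht.le).2.2.2.2.1 (hs t ht.le).2.2.2.2.2
        rwa [sub_add_cancel]
      β_pos := fun t ht => hβ_pos t ht.le
      deriv_β := fun t ht => ((hβ_diff.differentiableOn one_ne_zero) t
        (mem_Ici.2 ht.le)).hasDerivWithinAt.hasDerivAt (Ici_mem_nhds ht)
      β'_nonneg := fun t ht => hβ_mono.derivWithin_nonneg
      β'_le := fun t ht => by
        have h1 := hβ' t ht.le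
        have h0 := ht₀.trans ht
        have h2 : 0 < M / t := by positivity
        have h3 := Real.rpow_pos_of_pos h0 q
        rw [div_le_iff₀ (hβ_pos t ht.le)] at h1
        have h4 : derivWithin β (Ici t₀) t ≤ (α - 1) / t ^ q * β t :=
          h1.trans (mul_le_mul_of_nonneg_right (by linarith) (hβ_pos t ht.le).le)
        refine (mul_le_mul_of_nonneg_right h4 (by positivity)).trans_eq ?_
        field_simp
      tendsto_weight := by
        -- As 2α - 1 > 1, the bound on M is at most 2q; thus Q = (c/a²) t^(2q-p) β dominates (c/a²)
        -- t^(M-p) β for t ≥ 1.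
        have hM2 : M ≤ 2 * q := by
          have : 1 / (2 * α - 1) ≤ 1 := by
            rw [div_le_one (by linarith)]; linarith
          nlinarith
        refine tendsto_atTop_mono' _ ?_
          (hlim.const_mul_atTop (show 0 < c / (α - 1) ^ 2 by positivity))
        filter_upwards [eventually_ge_atTop 1, eventually_ge_atTop t₀] with t h1 h2
        have h0 : 0 < t := by linarith
        have h3 : t ^ (M - p) ≤ t ^ (2 * q - p) := Real.rpow_le_rpow_of_exponent_le h1 (by linarith)
        have h4 : t ^ (2 * q - p) = (t ^ q) ^ 2 / t ^ p := by
          rw [Real.rpow_sub h0, mul_comm 2 q, Real.rpow_mul h0.le, Real.rpow_two]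
        have hβ := hβ_pos t h2
        calc _ ≤ c / (α - 1) ^ 2 * ((t ^ q) ^ 2 / t ^ p * β t) := by rw [← h4]; gcongr
          _ = _ := by field_simp }
  -- If J u = J w then ⟨J w, u⟩ = ⟨J u, u⟩ = 0, so zero gap means φ(u) = φ(w), and u inherits the
  -- saddle inequality of w.
  have hw : ∀ u, IsTikhonovFlow.gap (sepSum f g) (skewCoupling K) w u = 0 →
      skewCoupling K u = skewCoupling K w → ‖u‖ ≤ ‖w‖ → u = w := by
    intro u h1 h2
    refine huniq u ((mem_saddleSet_iff K).2 fun v => ?_)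
    have h3 := (mem_saddleSet_iff K).1 hwΩ v
    have h4 : inner ℝ (skewCoupling K w) u = 0 := by
      rw [← h2, real_inner_comm]; exact inner_skewCoupling_self K u
    rw [IsTikhonovFlow.gap, h4] at h1
    rw [h2]
    linarith
  refine ⟨w, hproj, ?_, ?_⟩
  · obtain ⟨l, hl0, hl, hlw⟩ := hflow.exists_tendsto hw
    apply le_antisymm
    · have h1 : Tendsto (fun t : ℝ => ((‖WithLp.toLp 2 (x t, y t) - w‖ : ℝ) : EReal)) l (𝓝 0) :=
        EReal.tendsto_coe.2 (tendsto_iff_norm_sub_tendsto_zero.1 hlw)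
      exact (liminf_le_liminf_of_le hl).trans h1.liminf_eq.le
    · exact le_liminf_of_le (by isBoundedDefault)
        (Eventually.of_forall fun t => EReal.coe_nonneg.2 (norm_nonneg _))
  · rintro ⟨T, -, hT | hT⟩
    · refine tendsto_iff_norm_sub_tendsto_zero.1 (hflow.tendsto_of_norm_le hw le_rfl ?_)
      filter_upwards [eventually_ge_atTop T] with t ht
      exact (mem_ball_zero_iff.1 (hT t ht)).le
    · refine tendsto_iff_norm_sub_tendsto_zero.1 (hflow.tendsto_of_norm_ge hw ?_)
      filter_upwards [eventually_ge_atTop T] with t ht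
      simpa using hT t ht
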